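/- Let $K$ be a field. For integers $n\ge 3$ and $m\ge 2$ let $A_{n,m}=K\vec A_n/\mathcal I_m$, where $\vec A_n$ is the linearly oriented quiver $1\to 2\to\cdots\to n$ and $\mathcal I_m$ is the two-sided ideal generated by all paths of length $m$ (length counted in arrows), i.e. by the full set of fully overlapped zero relations of length $m$. For an algebra $A$, let $\operatorname{dom.dim}A\in\{0,1,2,\dots\}\cup\{\infty\}$ be the supremum of all $k\ge 0$ such that in a minimal injective resolution $0\to {}_AA\to I_1\to I_2\to\cdots$ of the left regular module the terms $I_1,\dots,I_k$ are all projective. Then: 1. $\operatorname{dom.dim}A_{n,2}=n-1$ for every $n\ge 3$. 2. If $m\ge 3$ and $n=mk+j$ with integers $k\ge 1$ and $1\le j\le m$, then $$\operatorname{dom.dim}A_{n,m}=\begin{cases}\dfrac{2n-(m+2j)}{m}, & 1\le j\le m-2,\\[2mm] \dfrac{2n-2j}{m}, & j=m-1,\\[2mm] \dfrac{2n-j}{m}, & j=m.\end{cases}$$ In particular these fractions are integers and the dominant dimension is finite. 3. Consequently every positive integer $d$ occurs as a dominant dimension: over every field $K$ there are $n\ge 3$ and $2\le m<n$ with $\operatorname{dom.dim}A_{n,m}=d$.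 -/

import Mathlib

universe u v w

/-! ### Path algebras and quotients by zero relations -/

/-- Bilinear extension of the concatenation of paths `a ⟶ b ⟶ c` in a quiver. -/
noncomputable def pathConcat (K : Type u) [Field K] {V : Type v} [Quiver.{w} V] (a b c : V) :
    (Quiver.Path a b →₀ K) →ₗ[K] (Quiver.Path b c →₀ K) →ₗ[K] (Quiver.Path a c →₀ K) :=
  Finsupp.lsum K fun p => (LinearMap.lsmul K _).flip (Finsupp.lmapDomain K K fun q => p.comp q)

theorem pathConcat_single (K : Type u) [Field K] {V : Type v} [Quiver.{w} V] {a b c : V}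
    (p : Quiver.Path a b) (q : Quiver.Path b c) (r s : K) :
    pathConcat K a b c (Finsupp.single p r) (Finsupp.single q s) =
      Finsupp.single (p.comp q) (r * s) := by
  simp [pathConcat, Finsupp.mapDomain_single]

theorem pathConcat_assoc (K : Type u) [Field K] {V : Type v} [Quiver.{w} V] {a b c d : V}
    (x : Quiver.Path a b →₀ K) (y : Quiver.Path b c →₀ K) (z : Quiver.Path c d →₀ K) :
    pathConcat K a c d (pathConcat K a b c x y) z =
      pathConcat K a b d x (pathConcat K b c d y z) := by
  induction x using Finsupp.induction_linear with
  | zero => simp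
  | add x₁ x₂ h₁ h₂ => simp [h₁, h₂]
  | single p r =>
    induction y using Finsupp.induction_linear with
    | zero => simp
    | add y₁ y₂ h₁ h₂ => simp [h₁, h₂]
    | single q s =>
      induction z using Finsupp.induction_linear with
      | zero => simp
      | add z₁ z₂ h₁ h₂ => simp [h₁, h₂]
      | single t k =>
        rw [pathConcat_single, pathConcat_single, pathConcat_single, pathConcat_single,
          Quiver.Path.comp_assoc, mul_assoc]

theorem pathConcat_nil_left (K : Type u) [Field K] {V : Type v} [Quiver.{w} V] {a b : V}
    (x : Quiver.Path a b →₀ K) :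
    pathConcat K a a b (Finsupp.single Quiver.Path.nil 1) x = x := by
  induction x using Finsupp.induction_linear with
  | zero => simp
  | add x₁ x₂ h₁ h₂ => simp [h₁, h₂]
  | single p r => simp [pathConcat_single]

theorem pathConcat_nil_right (K : Type u) [Field K] {V : Type v} [Quiver.{w} V] {a b : V}
    (x : Quiver.Path a b →₀ K) :
    pathConcat K a b b x (Finsupp.single Quiver.Path.nil 1) = x := by
  induction x using Finsupp.induction_linear with
  | zero => simp
  | add x₁ x₂ h₁ h₂ => simp [h₁, h₂]
  | single p r => simp [pathConcat_single]

/-- The path algebra `KQ` of a quiver `Q` with vertex set `V` (finite, for the ring structure below):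
formal `K`-linear combinations of the paths of `Q`, grouped by source and target. -/
def PathAlgebra (K : Type u) [Field K] (V : Type v) [Quiver.{w} V] : Type (max u v w) :=
  ∀ a b : V, Quiver.Path a b →₀ K

namespace PathAlgebra

noncomputable instance (K : Type u) [Field K] (V : Type v) [Quiver.{w} V] :
    AddCommGroup (PathAlgebra K V) :=
  inferInstanceAs (AddCommGroup (∀ a b : V, Quiver.Path a b →₀ K))

/-- The product `x * y` of two paths is "first `y`, then `x`" if the target of `y` is the source of
`x`, and `0` otherwise. So the indecomposable projective left module `P(a) = A e_a` is spanned by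
the paths with source `a`. -/
noncomputable instance (K : Type u) [Field K] (V : Type v) [Quiver.{w} V] [Fintype V]
    [DecidableEq V] : Ring (PathAlgebra K V) where
  __ := (inferInstance : AddCommGroup (PathAlgebra K V))
  mul x y := fun a c => ∑ b, pathConcat K a b c (y a b) (x b c)
  one := fun a => Pi.single a (Finsupp.single Quiver.Path.nil 1)
  left_distrib x y z := by
    funext a c
    change ∑ b, pathConcat K a b c (y a b + z a b) (x b c) =
      ∑ b, pathConcat K a b c (y a b) (x b c) + ∑ b, pathConcat K a b c (z a b) (x b c)
    simp [Finset.sum_add_distrib]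
  right_distrib x y z := by
    funext a c
    change ∑ b, pathConcat K a b c (z a b) (x b c + y b c) =
      ∑ b, pathConcat K a b c (z a b) (x b c) + ∑ b, pathConcat K a b c (z a b) (y b c)
    simp [Finset.sum_add_distrib]
  zero_mul x := by
    funext a c
    change ∑ b, pathConcat K a b c (x a b) 0 = 0
    simp
  mul_zero x := by
    funext a c
    change ∑ b, pathConcat K a b c 0 (x b c) = 0
    simp
  mul_assoc x y z := by
    funext a d
    change ∑ b, pathConcat K a b d (z a b) (∑ c, pathConcat K b c d (y b c) (x c d)) =
      ∑ c, pathConcat K a c d (∑ b, pathConcat K a b c (z a b) (y b c)) (x c d)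
    simp only [map_sum, LinearMap.sum_apply, pathConcat_assoc]
    exact Finset.sum_comm
  one_mul x := by
    funext a c
    change ∑ b, pathConcat K a b c (x a b)
      ((Pi.single b (Finsupp.single Quiver.Path.nil 1) : ∀ c, Quiver.Path b c →₀ K) c) = x a c
    rw [Finset.sum_eq_single c]
    · rw [Pi.single_eq_same, pathConcat_nil_right]
    · intro b _ hb
      rw [Pi.single_eq_of_ne hb.symm, map_zero]
    · simp
  mul_one x := by
    funext a c
    change ∑ b, pathConcat K a b c
      ((Pi.single a (Finsupp.single Quiver.Path.nil 1) : ∀ b, Quiver.Path a b →₀ K) b) (x b c) =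
        x a c
    rw [Finset.sum_eq_single a]
    · rw [Pi.single_eq_same, pathConcat_nil_left]
    · intro b _ hb
      rw [Pi.single_eq_of_ne hb, map_zero, LinearMap.zero_apply]
    · simp

/-- A path, as an element of the path algebra. -/
noncomputable def ofPath (K : Type u) [Field K] {V : Type v} [Quiver.{w} V] [DecidableEq V]
    {a b : V} (p : Quiver.Path a b) : PathAlgebra K V :=
  Pi.single a (Pi.single b (Finsupp.single p 1) : ∀ b, Quiver.Path a b →₀ K)

end PathAlgebra

/-- The two-sided ideal of `KQ` generated by the zero relations in `R`, i.e. by a set `R` of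
paths. -/
noncomputable def zeroRelationIdeal (K : Type u) [Field K] {V : Type v} [Quiver.{w} V] [Fintype V]
    [DecidableEq V] (R : ∀ a b : V, Set (Quiver.Path a b)) : TwoSidedIdeal (PathAlgebra K V) :=
  TwoSidedIdeal.span {x | ∃ (a b : V) (p : Quiver.Path a b), p ∈ R a b ∧ x = PathAlgebra.ofPath K p}

/-- The bound quiver algebra `KQ / ⟨R⟩` for a set `R` of zero relations. -/
abbrev BoundQuiverAlgebra (K : Type u) [Field K] {V : Type v} [Quiver.{w} V] [Fintype V]
    [DecidableEq V] (R : ∀ a b : V, Set (Quiver.Path a b)) : Type (max u v w) :=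
  (zeroRelationIdeal K R).ringCon.Quotient

/-! ### The linearly oriented quiver of type `A_n` -/

/-- The vertices of the linearly oriented quiver `1 ⟶ 2 ⟶ ⋯ ⟶ n` (numbered here from `0` to
`n - 1`). -/
def LinearQuiver (n : ℕ) : Type := Fin n

namespace LinearQuiver

instance (n : ℕ) : Fintype (LinearQuiver n) := inferInstanceAs (Fintype (Fin n))

instance (n : ℕ) : DecidableEq (LinearQuiver n) := inferInstanceAs (DecidableEq (Fin n))

/-- The position of a vertex. -/
def pos {n : ℕ} (i : LinearQuiver n) : ℕ := Fin.val i

/-- There is exactly one arrow from each vertex to the next one, and no other arrow. -/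
instance (n : ℕ) : Quiver.{0} (LinearQuiver n) where
  Hom i j := PLift (j.pos = i.pos + 1)

/-- The full set of fully overlapped zero relations of length `m`: every path of length `m` is a
relation, so that the relations start at all the consecutive vertices `1, 2, …, n - m`. -/
def fullRelations (n m : ℕ) (a b : LinearQuiver n) : Set (Quiver.Path a b) :=
  {p | p.length = m}

end LinearQuiver

/-- The bound quiver algebra of `1 ⟶ 2 ⟶ ⋯ ⟶ n` with all paths of length `m` as zero relations. -/
abbrev LinearBoundAlgebra (K : Type u) [Field K] (n m : ℕ) : Type u :=
  BoundQuiverAlgebra K (LinearQuiver.fullRelations n m)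

/-! ### Dominant dimension -/

/-- A submodule is essential if it meets every nonzero submodule nontrivially. -/
def IsEssentialSubmodule {A : Type u} [Ring A] {M : Type v} [AddCommGroup M] [Module A M]
    (N : Submodule A M) : Prop :=
  ∀ S : Submodule A M, N ⊓ S = ⊥ → S = ⊥

/-- A minimal injective resolution `0 ⟶ M ⟶ I 0 ⟶ I 1 ⟶ ⋯` of a left module `M`: an exact sequence
with injective terms `I i`, such that each `I i` is an injective envelope of the image of the map
into it. -/
structure MinimalInjectiveResolution (A : Type u) [Ring A] (M : Type u) [AddCommGroup M]
    [Module A M] where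
  I : ℕ → ModuleCat.{u} A
  ε : M →ₗ[A] I 0
  d : ∀ i, I i →ₗ[A] I (i + 1)
  injective_I : ∀ i, Module.Injective A (I i)
  injective_ε : Function.Injective ε
  exact_ε : Function.Exact ε (d 0)
  exact_d : ∀ i, Function.Exact (d i) (d (i + 1))
  essential_ε : IsEssentialSubmodule (LinearMap.range ε)
  essential_d : ∀ i, IsEssentialSubmodule (LinearMap.range (d i))

/-- `dom.dim M ≥ k`: the first `k` terms of some minimal injective resolution of `M` are projective
(and injective). -/
def DominantDimensionGE (A : Type u) [Ring A] (M : Type u) [AddCommGroup M] [Module A M]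
    (k : ℕ) : Prop :=
  ∃ r : MinimalInjectiveResolution A M, ∀ i < k, Module.Projective A (r.I i)

/-- The dominant dimension of a left module: the supremum in `ℕ ∪ {∞}` of all `k` with
`dom.dim M ≥ k`. -/
noncomputable def dominantDimension (A : Type u) [Ring A] (M : Type u) [AddCommGroup M]
    [Module A M] : ℕ∞ :=
  ⨆ k : {k : ℕ // DominantDimensionGE A M k}, (k.1 : ℕ∞)

/-- The dominant dimension of an algebra is that of its left regular module. -/
noncomputable def algDominantDimension (A : Type u) [Ring A] : ℕ∞ :=
  dominantDimension A A

/-! Vertices are counted from 0. Two vertices are joined by at most one path, so the path algebra is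
the algebra of lower triangular matrices, and its quotient acts on any m consecutive vertices. Let
I(b) be the module on the vertices c with b - m < c ≤ b. For b < n it is injective
(`injective_of_lt`), and zero for b < 0. If b ≥ m - 1 it is the projective P(b - m + 1)
(`projective_of_vertex`); if 0 ≤ b ≤ m - 2 and b + 1 < n it is a proper quotient of I(b + 1) and not
projective (`not_projective`).

The projective P(a) lives on a, …, min(a + m, n) - 1. If a + m ≤ n it equals I(a + m - 1). Otherwise
it embeds in I(n - 1); the cokernel ends at a - 1 and embeds in I(a - 1); the next cokernel ends at
n - 1 - m, and so on. The socles are n - 1, a - 1, n - 1 - m, a - 1 - m, …, and the sum over a is a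
minimal injective resolution of the algebra (`resolution`). Minimal resolutions are unique, so the
dominant dimension is the first index, counted from 0, at which some socle falls into 0, …, m - 2.

Let n = mk + j. At index 2t the socle is m(k - t) + j - 1. At index 2t + 1 the smallest one comes
from a = n - m + 1 and is m(k - 1 - t) + j. The first bad value is thus j at index 2k - 1 if j ≤ m -
2, m - 2 at index 2k if j = m - 1, and 0 at index 2k + 1 if j = m. -/

/-! ### Uniqueness of minimal injective resolutions -/

section Resolution

variable {A : Type u} [Ring A]

/-- An isomorphism compatible with the kernels of two maps onto essential submodules of injective
modules extends to the injective modules. -/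
theorem exists_linearEquiv_of_essential {X X' I I' : Type u} [AddCommGroup X] [Module A X]
    [AddCommGroup X'] [Module A X'] [AddCommGroup I] [Module A I] [AddCommGroup I'] [Module A I']
    (hI : Module.Injective A I) (hI' : Module.Injective A I') (f : X →ₗ[A] I) (f' : X' →ₗ[A] I')
    (hf : IsEssentialSubmodule (LinearMap.range f))
    (hf' : IsEssentialSubmodule (LinearMap.range f')) (e : X ≃ₗ[A] X')
    (he : ∀ x, f x = 0 ↔ f' (e x) = 0) :
    ∃ e' : I ≃ₗ[A] I', ∀ x, e' (f x) = f' (e x) := by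
  let g : LinearMap.range f →ₗ[A] I' :=
    ((LinearMap.ker f).liftQ (f'.comp e.toLinearMap) fun x hx => (he x).1 hx).comp
      f.quotKerEquivRange.symm.toLinearMap
  have hg : ∀ x, g ⟨f x, x, rfl⟩ = f' (e x) := fun x => by
    have : f.quotKerEquivRange.symm ⟨f x, x, rfl⟩ = (LinearMap.ker f).mkQ x := by
      rw [LinearEquiv.symm_apply_eq]; rfl
    simp only [g, LinearMap.comp_apply, LinearEquiv.coe_coe, this]
    rfl
  obtain ⟨h, hh⟩ := hI'.out (LinearMap.range f).subtype (Submodule.injective_subtype _) g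
  have hhf : ∀ x, h (f x) = f' (e x) := fun x => (hh ⟨f x, x, rfl⟩).trans (hg x)
  have hinj : Function.Injective h := by
    rw [← LinearMap.ker_eq_bot]
    apply hf
    rw [eq_bot_iff]
    rintro _ ⟨⟨x, rfl⟩, hx⟩
    exact (he x).2 ((hhf x).symm.trans hx)
  -- The retraction `p` of `h` sends `f' (e x)` back to `f x`, so it is injective on the essential
  -- range of `f'`, hence everywhere. This makes `h` surjective.
  obtain ⟨p, hp⟩ := hI.out h hinj LinearMap.id
  have pinj : Function.Injective p := by
    rw [← LinearMap.ker_eq_bot]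
    apply hf'
    rw [eq_bot_iff]
    rintro _ ⟨⟨x, rfl⟩, hx⟩
    obtain ⟨x, rfl⟩ := e.surjective x
    have hx : p (f' (e x)) = 0 := hx
    rw [← hhf, hp] at hx
    exact (he x).1 hx
  exact ⟨LinearEquiv.ofBijective h ⟨hinj, fun y => ⟨p y, pinj (hp _)⟩⟩, hhf⟩

/-- The terms of a minimal injective resolution are unique up to isomorphism. -/
theorem MinimalInjectiveResolution.nonempty_linearEquiv {M : Type u} [AddCommGroup M] [Module A M]
    (r r' : MinimalInjectiveResolution A M) (i : ℕ) : Nonempty (r.I i ≃ₗ[A] r'.I i) := by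
  -- Compatibility with the kernels of the differentials must be carried through the induction: it
  -- is the hypothesis for extending the isomorphism to the next term.
  suffices H : ∃ e : r.I i ≃ₗ[A] r'.I i, ∀ x, r.d i x = 0 ↔ r'.d i (e x) = 0 from
    H.elim fun e _ => ⟨e⟩
  induction i with
  | zero =>
    obtain ⟨e, he⟩ := exists_linearEquiv_of_essential (r.injective_I 0) (r'.injective_I 0) r.ε r'.ε
      r.essential_ε r'.essential_ε (LinearEquiv.refl A M) fun x => by
        simp [map_eq_zero_iff _ r.injective_ε, map_eq_zero_iff _ r'.injective_ε]
    refine ⟨e, fun x => ?_⟩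
    rw [r.exact_ε x, r'.exact_ε (e x)]
    refine ⟨fun ⟨y, hy⟩ => ⟨y, by rw [← hy, he]; rfl⟩, fun ⟨y, hy⟩ => ⟨y, e.injective ?_⟩⟩
    rw [he, ← hy]; rfl
  | succ i ih =>
    obtain ⟨e₀, he₀⟩ := ih
    obtain ⟨e, he⟩ := exists_linearEquiv_of_essential (r.injective_I _) (r'.injective_I _)
      (r.d i) (r'.d i) (r.essential_d i) (r'.essential_d i) e₀ he₀
    refine ⟨e, fun x => ?_⟩
    rw [r.exact_d i x, r'.exact_d i (e x)]
    refine ⟨fun ⟨y, hy⟩ => ⟨e₀ y, by rw [← hy, he]⟩,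
      fun ⟨y, hy⟩ => ⟨e₀.symm y, e.injective ?_⟩⟩
    rw [he, ← hy, LinearEquiv.apply_symm_apply]

/-- The dominant dimension can be read off from any minimal injective resolution. -/
theorem dominantDimension_eq_of_resolution {M : Type u} [AddCommGroup M] [Module A M]
    (r : MinimalInjectiveResolution A M) (d : ℕ) (h : ∀ i < d, Module.Projective A (r.I i))
    (hd : ¬ Module.Projective A (r.I d)) : dominantDimension A M = d := by
  apply le_antisymm
  · refine iSup_le fun ⟨k, r', hr'⟩ => ?_
    by_contra hk
    have hk : d < k := by simpa using hk
    obtain ⟨e⟩ := r'.nonempty_linearEquiv r d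
    have := hr' d hk
    exact hd (Module.Projective.of_equiv' e)
  · exact le_iSup (fun k : {k : ℕ // DominantDimensionGE A M k} => (k.1 : ℕ∞)) ⟨d, r, h⟩

/-- A submodule containing the kernel of a locally nilpotent multiplication is essential. -/
theorem isEssentialSubmodule_of_ker_smul_le {M : Type v} [AddCommGroup M] [Module A M]
    (N : Submodule A M) (t : A) (hker : ∀ x : M, t • x = 0 → x ∈ N)
    (hnil : ∀ x : M, ∃ k : ℕ, t ^ k • x = 0) : IsEssentialSubmodule N := by
  intro S hS
  rw [eq_bot_iff]
  intro x hx
  obtain ⟨k, hk⟩ := hnil x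
  change x = 0
  induction k with
  | zero => simpa using hk
  | succ k ih =>
    apply ih
    -- This element lies in the kernel of `t`, hence in `N`, and in `S`; so it vanishes and the
    -- exponent drops by one.
    have : t ^ k • x ∈ N ⊓ S :=
      ⟨hker _ (by rw [← mul_smul, ← pow_succ', hk]), S.smul_mem _ hx⟩
    rwa [hS] at this

/-- The factors of a projective product are projective. -/
theorem Module.Projective.of_pi {ι : Type*} [DecidableEq ι] (M : ι → Type*)
    [∀ i, AddCommGroup (M i)] [∀ i, Module A (M i)] [Module.Projective A (∀ i, M i)] (i : ι) :
    Module.Projective A (M i) :=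
  .of_split (LinearMap.single A M i) (LinearMap.proj i) (by ext; simp)

/-- Finite products of projective modules are projective. -/
theorem Module.Projective.pi_of_fintype {ι : Type*} [Fintype ι] [DecidableEq ι] (M : ι → Type*)
    [∀ i, AddCommGroup (M i)] [∀ i, Module A (M i)] (h : ∀ i, Module.Projective A (M i)) :
    Module.Projective A (∀ i, M i) :=
  .of_equiv' (DFinsupp.linearEquivFunOnFintype (R := A) (M := M))

end Resolution

/-! ### The path algebra as an algebra over the base field -/

namespace PathAlgebra

variable (K : Type u) [Field K] (V : Type v) [Quiver.{w} V]

noncomputable instance : Module K (PathAlgebra K V) :=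
  inferInstanceAs (Module K (∀ a b : V, Quiver.Path a b →₀ K))

variable [Fintype V] [DecidableEq V]

variable {K V} in
theorem mul_apply (x y : PathAlgebra K V) (a c : V) :
    (x * y) a c = ∑ b, pathConcat K a b c (y a b) (x b c) := rfl

noncomputable instance : Algebra K (PathAlgebra K V) :=
  Algebra.ofModule
    (fun r x y => by
      funext a c
      change ∑ b, pathConcat K a b c (y a b) (r • x b c) =
        r • ∑ b, pathConcat K a b c (y a b) (x b c)
      simp [Finset.smul_sum])
    (fun r x y => by
      funext a c
      change ∑ b, pathConcat K a b c (r • y a b) (x b c) =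
        r • ∑ b, pathConcat K a b c (y a b) (x b c)
      simp [Finset.smul_sum])

/-- The sum of the coefficients. -/
noncomputable def coeffSum {V : Type v} [Quiver.{w} V] (a b : V) :
    (Quiver.Path a b →₀ K) →ₗ[K] K :=
  Finsupp.lsum K fun _ => LinearMap.id

theorem coeffSum_single {V : Type v} [Quiver.{w} V] {a b : V} (p : Quiver.Path a b) (r : K) :
    coeffSum K a b (Finsupp.single p r) = r := by
  simp [coeffSum]

theorem coeffSum_pathConcat {V : Type v} [Quiver.{w} V] {a b c : V}
    (x : Quiver.Path a b →₀ K) (y : Quiver.Path b c →₀ K) :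
    coeffSum K a c (pathConcat K a b c x y) = coeffSum K a b x * coeffSum K b c y := by
  induction x using Finsupp.induction_linear with
  | zero => simp
  | add x₁ x₂ h₁ h₂ => simp [h₁, h₂, add_mul]
  | single p r =>
    induction y using Finsupp.induction_linear with
    | zero => simp
    | add y₁ y₂ h₁ h₂ => simp [h₁, h₂, mul_add]
    | single q s => rw [pathConcat_single, coeffSum_single, coeffSum_single, coeffSum_single]

/-- The matrix of coefficients of an element of the path algebra; the column index is the source
and the row index the target. -/
noncomputable def toMatrix : PathAlgebra K V →ₐ[K] Matrix V V K :=
  AlgHom.ofLinearMap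
    { toFun := fun x => Matrix.of fun c a => coeffSum K a c (x a c)
      map_add' := fun x y => by
        ext c a
        exact map_add (coeffSum K a c) (x a c) (y a c)
      map_smul' := fun r x => by
        ext c a
        exact map_smul (coeffSum K a c) r (x a c) }
    (by
      ext c a
      change coeffSum K a c
        ((Pi.single a (Finsupp.single Quiver.Path.nil 1) : ∀ c, Quiver.Path a c →₀ K) c) = _
      by_cases h : c = a
      · subst h
        rw [Pi.single_eq_same, coeffSum_single, Matrix.one_apply_eq]
      · rw [Pi.single_eq_of_ne h, map_zero, Matrix.one_apply_ne h])
    (fun x y => by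
      ext c a
      change coeffSum K a c ((x * y) a c) =
        ∑ b, coeffSum K b c (x b c) * coeffSum K a b (y a b)
      rw [mul_apply, map_sum]
      exact Finset.sum_congr rfl fun b _ => by rw [coeffSum_pathConcat, mul_comm])

theorem toMatrix_apply (x : PathAlgebra K V) (c a : V) :
    toMatrix K V x c a = coeffSum K a c (x a c) := rfl

theorem toMatrix_ofPath {a b : V} (p : Quiver.Path a b) (c d : V) :
    toMatrix K V (ofPath K p) c d = if d = a ∧ c = b then 1 else 0 := by
  rw [toMatrix_apply, ofPath]
  by_cases h : d = a
  · subst h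
    rw [Pi.single_eq_same]
    by_cases h' : c = b
    · subst h'
      rw [Pi.single_eq_same, coeffSum_single]; simp
    · rw [Pi.single_eq_of_ne h', map_zero]; simp [h']
  · rw [Pi.single_eq_of_ne h, Pi.zero_apply, map_zero]; simp [h]

end PathAlgebra

/-! ### Paths of the linear quiver -/

namespace LinearQuiver

variable {n : ℕ}

theorem pos_lt (i : LinearQuiver n) : i.pos < n := Fin.isLt i

theorem pos_injective : Function.Injective (pos (n := n)) := Fin.val_injective

/-- The vertex at a given position. -/
def vertex (k : ℕ) (h : k < n) : LinearQuiver n := (⟨k, h⟩ : Fin n)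

theorem pos_vertex (k : ℕ) (h : k < n) : (vertex k h).pos = k := rfl

theorem pos_add_length {a b : LinearQuiver n} (p : Quiver.Path a b) :
    a.pos + p.length = b.pos := by
  induction p with
  | nil => rfl
  | cons p e ih => rw [Quiver.Path.length_cons, e.down, ← ih]; omega

/-- Every arrow raises the position by one, so the last arrow of a path is determined by its target.
This uniqueness is what makes coefficient matrices faithful. -/
instance subsingleton_path (a b : LinearQuiver n) : Subsingleton (Quiver.Path a b) := by
  refine ⟨fun p => ?_⟩
  induction p with
  | nil =>
    intro q
    have := pos_add_length q
    exact (Quiver.Path.eq_nil_of_length_zero q (by omega)).symm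
  | @cons b c p e ih =>
    intro q
    cases q with
    | nil =>
      have h₁ := pos_add_length p
      have h₂ := e.down
      omega
    | @cons b' _ q e' =>
      have : b = b' := pos_injective (by have := e.down; have := e'.down; omega)
      subst this
      obtain ⟨_⟩ := e
      obtain ⟨_⟩ := e'
      rw [ih q]

theorem nonempty_path {a b : LinearQuiver n} (h : a.pos ≤ b.pos) : Nonempty (Quiver.Path a b) := by
  obtain ⟨k, hk⟩ := Nat.exists_eq_add_of_le h
  induction k generalizing b with
  | zero =>
    have : a = b := pos_injective (by omega)
    subst this
    exact ⟨.nil⟩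
  | succ k ih =>
    have hb := b.pos_lt
    obtain ⟨p⟩ := @ih (vertex (a.pos + k) (by omega)) (by rw [pos_vertex]; omega) (pos_vertex _ _)
    exact ⟨p.cons ⟨by rw [pos_vertex]; omega⟩⟩

end LinearQuiver

/-! ### Matrix description of the bound quiver algebra -/

namespace LinearQuiver

variable (K : Type u) [Field K] {n : ℕ}

theorem toMatrix_eq_zero (x : PathAlgebra K (LinearQuiver n)) {a c : LinearQuiver n}
    (h : c.pos < a.pos) : PathAlgebra.toMatrix K _ x c a = 0 := by
  have : IsEmpty (Quiver.Path a c) := ⟨fun p => by have := pos_add_length p; omega⟩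
  rw [PathAlgebra.toMatrix_apply, Subsingleton.elim (x a c) 0, map_zero]

theorem toMatrix_injective : Function.Injective (PathAlgebra.toMatrix K (LinearQuiver n)) := by
  intro x y h
  have key : ∀ (a c : LinearQuiver n) (z : Quiver.Path a c →₀ K) (p : Quiver.Path a c),
      PathAlgebra.coeffSum K a c z = z p := fun a c z p => by
    induction z using Finsupp.induction_linear with
    | zero => simp
    | add z₁ z₂ h₁ h₂ => simp [h₁, h₂]
    | single q r =>
      rw [PathAlgebra.coeffSum_single, Subsingleton.elim q p, Finsupp.single_eq_same]
  funext a c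
  ext p
  rw [← key, ← key]
  exact congrFun (congrFun h c) a

variable {K} in
/-- The element of the path algebra with a given lower triangular matrix of coefficients. -/
noncomputable def ofMatrix (M : Matrix (LinearQuiver n) (LinearQuiver n) K) :
    PathAlgebra K (LinearQuiver n) :=
  fun a c => if h : a.pos ≤ c.pos then Finsupp.single (nonempty_path h).some (M c a) else 0

theorem toMatrix_ofMatrix (M : Matrix (LinearQuiver n) (LinearQuiver n) K)
    (c a : LinearQuiver n) :
    PathAlgebra.toMatrix K _ (ofMatrix M) c a = if a.pos ≤ c.pos then M c a else 0 := by
  rw [PathAlgebra.toMatrix_apply, ofMatrix]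
  split_ifs
  · rw [PathAlgebra.coeffSum_single]
  · rw [map_zero]

/-- The path from `a` to `c` in the path algebra, or zero if there is none. -/
noncomputable def pathElem (a c : LinearQuiver n) : PathAlgebra K (LinearQuiver n) :=
  ofMatrix (Matrix.single c a 1)

theorem toMatrix_pathElem (a c i j : LinearQuiver n) :
    PathAlgebra.toMatrix K _ (pathElem K a c) i j =
      if a.pos ≤ c.pos ∧ i = c ∧ j = a then 1 else 0 := by
  rw [pathElem, toMatrix_ofMatrix, Matrix.single_apply]
  by_cases h₁ : c = i <;> by_cases h₂ : a = j
  · subst h₁; subst h₂; simp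
  · simp [h₂, Ne.symm h₂]
  · simp [h₁, Ne.symm h₁]
  · simp [h₁, Ne.symm h₁]

theorem pathElem_eq_ofPath {a c : LinearQuiver n} (p : Quiver.Path a c) :
    pathElem K a c = PathAlgebra.ofPath K p := by
  apply toMatrix_injective
  ext i j
  have := pos_add_length p
  rw [toMatrix_pathElem, PathAlgebra.toMatrix_ofPath]
  exact if_congr ⟨fun h => ⟨h.2.2, h.2.1⟩, fun h => ⟨by omega, h.2, h.1⟩⟩ rfl rfl

theorem pathElem_mul {a c : LinearQuiver n} (h : a.pos ≤ c.pos)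
    (x : PathAlgebra K (LinearQuiver n)) :
    pathElem K a c * x = ∑ i, PathAlgebra.toMatrix K _ x a i • pathElem K i c := by
  apply toMatrix_injective
  ext s t
  rw [map_mul, map_sum, Matrix.mul_apply, Matrix.sum_apply, Finset.sum_eq_single a,
    Finset.sum_eq_single t]
  · simp only [map_smul, Matrix.smul_apply, toMatrix_pathElem, smul_eq_mul]
    by_cases ht : t.pos ≤ a.pos
    · simp [h, ht.trans h]
    · rw [toMatrix_eq_zero K x (not_le.1 ht)]; simp
  · intro i _ hi
    simp [toMatrix_pathElem, hi.symm]
  · simp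
  · intro i _ hi
    simp [toMatrix_pathElem, hi]
  · simp

theorem mul_pathElem {a c : LinearQuiver n} (h : a.pos ≤ c.pos)
    (x : PathAlgebra K (LinearQuiver n)) :
    x * pathElem K a c = ∑ i, PathAlgebra.toMatrix K _ x i c • pathElem K a i := by
  apply toMatrix_injective
  ext s t
  rw [map_mul, map_sum, Matrix.mul_apply, Matrix.sum_apply, Finset.sum_eq_single c,
    Finset.sum_eq_single s]
  · simp only [map_smul, Matrix.smul_apply, toMatrix_pathElem, smul_eq_mul]
    by_cases hs : c.pos ≤ s.pos
    · simp [h, h.trans hs]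
    · rw [toMatrix_eq_zero K x (not_le.1 hs)]; simp
  · intro i _ hi
    simp [toMatrix_pathElem, hi.symm]
  · simp
  · intro i _ hi
    simp [toMatrix_pathElem, hi]
  · simp

theorem pathElem_mul_pathElem {a b c : LinearQuiver n} (hab : a.pos ≤ b.pos)
    (hbc : b.pos ≤ c.pos) : pathElem K b c * pathElem K a b = pathElem K a c := by
  rw [pathElem_mul K hbc, Finset.sum_eq_single a]
  · simp [toMatrix_pathElem, hab]
  · intro i _ hi
    simp [toMatrix_pathElem, hi]
  · simp

theorem eq_sum_pathElem (x : PathAlgebra K (LinearQuiver n)) :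
    x = ∑ a, ∑ c, PathAlgebra.toMatrix K _ x c a • pathElem K a c := by
  have h : (1 : PathAlgebra K (LinearQuiver n)) = ∑ a, pathElem K a a := by
    apply toMatrix_injective
    ext s t
    rw [map_one, map_sum, Matrix.sum_apply, Finset.sum_eq_single s]
    · simp [toMatrix_pathElem, Matrix.one_apply, eq_comm]
    · intro i _ hi
      simp [toMatrix_pathElem, hi.symm]
    · simp
  calc x = x * 1 := (mul_one x).symm
    _ = _ := by
      rw [h, Finset.mul_sum]
      exact Finset.sum_congr rfl fun a _ => mul_pathElem K le_rfl x

variable (n) in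
/-- The projection from the path algebra to the bound quiver algebra. -/
noncomputable def proj (m : ℕ) :
    PathAlgebra K (LinearQuiver n) →ₐ[K] LinearBoundAlgebra K n m :=
  (zeroRelationIdeal K (fullRelations n m)).ringCon.mkₐ K

theorem proj_surjective (m : ℕ) : Function.Surjective (proj K n m) :=
  Quotient.mk_surjective

theorem proj_pathElem_eq_zero (m : ℕ) {a c : LinearQuiver n} (h : a.pos + m ≤ c.pos) :
    proj K n m (pathElem K a c) = 0 := by
  have hc := c.pos_lt
  -- The path factors through the vertex `m` steps after `a`, and its initial part is a relation.
  let b : LinearQuiver n := vertex (a.pos + m) (by omega)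
  have hb : b.pos = a.pos + m := rfl
  obtain ⟨p⟩ := nonempty_path (a := a) (b := b) (by omega)
  have hp : p ∈ fullRelations n m a b := by
    have := pos_add_length p
    change p.length = m
    omega
  have h0 : proj K n m (pathElem K a b) = 0 := by
    rw [pathElem_eq_ofPath K p]
    refine (RingCon.eq _).2 ?_
    exact TwoSidedIdeal.subset_span ⟨a, b, p, hp, rfl⟩
  rw [← pathElem_mul_pathElem K (b := b) (by omega) (by omega), map_mul, h0, mul_zero]

/-! ### Interval modules over the bound quiver algebra -/

/-- The vertices `c` with `b - m < c ≤ b`. -/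
def InInterval (m : ℕ) (b : ℤ) (c : LinearQuiver n) : Prop := b - m < c.pos ∧ (c.pos : ℤ) ≤ b

instance (m : ℕ) (b : ℤ) : DecidablePred (InInterval (n := n) m b) :=
  fun _ => inferInstanceAs (Decidable (_ ∧ _))

theorem sum_interval {M : Type*} [AddCommMonoid M] (m : ℕ) (b : ℤ) (f : LinearQuiver n → M)
    (h : ∀ c, ¬ InInterval m b c → f c = 0) :
    ∑ c : {c : LinearQuiver n // InInterval m b c}, f c = ∑ c, f c := by
  rw [← Fintype.sum_subtype_add_sum_subtype (InInterval m b) f,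
    Fintype.sum_eq_zero (fun c : {c // ¬ InInterval m b c} => f c) fun c => h c.1 c.2, add_zero]

variable (n) in
/-- The representation of the path algebra on the interval module with socle at `b`. -/
noncomputable def intervalRep (m : ℕ) (b : ℤ) : PathAlgebra K (LinearQuiver n) →+*
    Matrix {c : LinearQuiver n // InInterval m b c} {c : LinearQuiver n // InInterval m b c} K where
  toFun x := (PathAlgebra.toMatrix K _ x).submatrix Subtype.val Subtype.val
  map_one' := by
    rw [map_one]
    exact Matrix.submatrix_one _ Subtype.val_injective
  map_mul' x y := by
    ext c a
    rw [map_mul]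
    simp only [Matrix.submatrix_apply, Matrix.mul_apply]
    -- Intervals are convex: a vertex `i` outside lies above `c` or below `a`, and triangularity
    -- kills one of the two factors.
    refine (sum_interval m b (fun i => PathAlgebra.toMatrix K _ x c i *
      PathAlgebra.toMatrix K _ y i a) fun i hi => ?_).symm
    have hc := c.2
    have ha := a.2
    simp only [InInterval] at hc ha hi
    by_cases h : c.1.pos < i.pos
    · rw [toMatrix_eq_zero K x h, zero_mul]
    · rw [toMatrix_eq_zero K y (by omega), mul_zero]
  map_zero' := by rw [map_zero]; rfl
  map_add' x y := by rw [map_add]; rfl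

theorem ringCon_le_ker_intervalRep (m : ℕ) (b : ℤ) :
    (zeroRelationIdeal K (fullRelations n m)).ringCon ≤ RingCon.ker (intervalRep K n m b) := by
  have h : zeroRelationIdeal K (fullRelations n m) ≤ TwoSidedIdeal.ker (intervalRep K n m b) := by
    refine TwoSidedIdeal.span_le.2 ?_
    rintro _ ⟨a, c, p, hp, rfl⟩
    refine (TwoSidedIdeal.mem_ker _).2 ?_
    ext i j
    have hp : p.length = m := hp
    have := pos_add_length p
    -- Two vertices of the interval are fewer than `m` steps apart, so no relation joins them.
    refine (PathAlgebra.toMatrix_ofPath K _ p i.1 j.1).trans (if_neg ?_)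
    rintro ⟨hj, hi⟩
    have h₁ := i.2
    have h₂ := j.2
    rw [hi] at h₁
    rw [hj] at h₂
    simp only [InInterval] at h₁ h₂
    omega
  exact TwoSidedIdeal.ringCon_le_iff.1 h

variable (n) in
/-- The representation of the bound quiver algebra on the interval module with socle at `b`. -/
noncomputable def boundIntervalRep (m : ℕ) (b : ℤ) : LinearBoundAlgebra K n m →+*
    Matrix {c : LinearQuiver n // InInterval m b c} {c : LinearQuiver n // InInterval m b c} K :=
  RingCon.lift _ (intervalRep K n m b) (ringCon_le_ker_intervalRep K m b)

/-- The interval module on the vertices `c` with `b - m < c ≤ b`: the injective envelope of the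
simple module at `b` if `b` is a vertex, and zero if `b` is negative. -/
def IntervalModule (K : Type u) (n m : ℕ) (b : ℤ) : Type u :=
  {c : LinearQuiver n // InInterval m b c} → K

namespace IntervalModule

variable {K} {m : ℕ} {b : ℤ}

noncomputable instance : AddCommGroup (IntervalModule K n m b) :=
  inferInstanceAs (AddCommGroup ({c : LinearQuiver n // InInterval m b c} → K))

noncomputable instance : Module (LinearBoundAlgebra K n m) (IntervalModule K n m b) where
  smul x v := (boundIntervalRep K n m b x).mulVec v
  one_smul v := (congrArg (Matrix.mulVec · v) (map_one (boundIntervalRep K n m b))).trans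
    (Matrix.one_mulVec v)
  mul_smul x y v := (congrArg (Matrix.mulVec · v) (map_mul (boundIntervalRep K n m b) x y)).trans
    (Matrix.mulVec_mulVec v _ _).symm
  smul_zero _ := Matrix.mulVec_zero _
  smul_add _ v w := Matrix.mulVec_add _ v w
  zero_smul v := (congrArg (Matrix.mulVec · v) (map_zero (boundIntervalRep K n m b))).trans
    (Matrix.zero_mulVec v)
  add_smul x y v := (congrArg (Matrix.mulVec · v) (map_add (boundIntervalRep K n m b) x y)).trans
    (Matrix.add_mulVec _ _ v)

/-- Extension by zero. -/
def ext0 (v : IntervalModule K n m b) (c : LinearQuiver n) : K :=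
  if h : InInterval m b c then v ⟨c, h⟩ else 0

theorem ext0_coe (v : IntervalModule K n m b) (c : {c : LinearQuiver n // InInterval m b c}) :
    v.ext0 c = v c := dif_pos c.2

theorem ext0_of_not (v : IntervalModule K n m b) {c : LinearQuiver n} (h : ¬ InInterval m b c) :
    v.ext0 c = 0 := dif_neg h

variable (m b) in
/-- The restriction of a function on the vertices to the interval. -/
def ofFun (f : LinearQuiver n → K) : IntervalModule K n m b := fun c => f c.1

theorem ofFun_apply (f : LinearQuiver n → K) (c : {c : LinearQuiver n // InInterval m b c}) :
    ofFun m b f c = f c := rfl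

theorem ext0_ofFun (f : LinearQuiver n → K) {c : LinearQuiver n} (h : InInterval m b c) :
    (ofFun m b f).ext0 c = f c := dif_pos h

theorem proj_smul_apply (x : PathAlgebra K (LinearQuiver n)) (v : IntervalModule K n m b)
    (c : {c : LinearQuiver n // InInterval m b c}) :
    (proj K n m x • v) c = ∑ i, PathAlgebra.toMatrix K _ x c i * v.ext0 i := by
  rw [← sum_interval m b _ fun i hi => by rw [ext0_of_not v hi, mul_zero]]
  change ∑ i, PathAlgebra.toMatrix K _ x c.1 i.1 * v i = _
  exact Finset.sum_congr rfl fun i _ => by rw [ext0_coe]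

theorem proj_smul_ext0 (x : PathAlgebra K (LinearQuiver n)) (v : IntervalModule K n m b)
    {c : LinearQuiver n} (h : InInterval m b c) :
    (proj K n m x • v).ext0 c = ∑ i, PathAlgebra.toMatrix K _ x c i * v.ext0 i :=
  (ext0_coe _ ⟨c, h⟩).trans (proj_smul_apply x v ⟨c, h⟩)

theorem proj_pathElem_smul_apply {a c : LinearQuiver n} (hac : a.pos ≤ c.pos)
    (v : IntervalModule K n m b) (i : {c : LinearQuiver n // InInterval m b c}) :
    (proj K n m (pathElem K a c) • v) i = if i.1 = c then v.ext0 a else 0 := by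
  rw [proj_smul_apply, Finset.sum_eq_single a]
  · simp [toMatrix_pathElem, hac]
  · intro j _ hj
    simp [toMatrix_pathElem, hj]
  · simp

theorem algebraMap_smul_apply (r : K) (v : IntervalModule K n m b)
    (c : {c : LinearQuiver n // InInterval m b c}) :
    (algebraMap K (LinearBoundAlgebra K n m) r • v) c = r * v c := by
  rw [← AlgHom.commutes (proj K n m), proj_smul_apply, AlgHom.commutes, Finset.sum_eq_single c.1]
  · rw [ext0_coe, Matrix.algebraMap_matrix_apply, if_pos rfl]; rfl
  · intro i _ hi
    rw [Matrix.algebraMap_matrix_apply, if_neg hi.symm, zero_mul]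
  · simp

end IntervalModule

end LinearQuiver

namespace LinearQuiver

variable {K : Type u} [Field K] {n m : ℕ}

namespace IntervalModule

variable {b : ℤ}

theorem ext0_add (v w : IntervalModule K n m b) (c : LinearQuiver n) :
    (v + w).ext0 c = v.ext0 c + w.ext0 c := by
  by_cases h : InInterval m b c
  · rw [ext0_coe (v + w) ⟨c, h⟩, ext0_coe v ⟨c, h⟩, ext0_coe w ⟨c, h⟩]; rfl
  · rw [ext0_of_not _ h, ext0_of_not _ h, ext0_of_not _ h, add_zero]

/-! ### Maps between interval modules -/

theorem ext0_ofFun_ext0 (v : IntervalModule K n m b) {b' : ℤ} (h : b' ≤ b)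
    {c : LinearQuiver n} (hc : (c.pos : ℤ) ≤ b') :
    (ofFun m b' v.ext0).ext0 c = v.ext0 c := by
  by_cases hc' : InInterval m b' c
  · exact ext0_ofFun _ hc'
  · rw [ext0_of_not _ hc', ext0_of_not]
    simp only [InInterval] at hc' ⊢
    omega

/-- The map of interval modules that kills the vertices above `b'`. -/
noncomputable def restrict {b' : ℤ} (h : b' ≤ b) :
    IntervalModule K n m b →ₗ[LinearBoundAlgebra K n m] IntervalModule K n m b' where
  toFun v := ofFun m b' v.ext0
  map_add' v w := funext fun c => ext0_add v w c.1
  map_smul' x v := by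
    obtain ⟨x, rfl⟩ := proj_surjective K m x
    funext c
    have hc := c.2
    rw [RingHom.id_apply, proj_smul_apply, ofFun_apply]
    have h₁ : ∀ i, PathAlgebra.toMatrix K _ x c i * (ofFun m b' v.ext0).ext0 i =
        PathAlgebra.toMatrix K _ x c i * v.ext0 i := fun i => by
      by_cases hi : c.1.pos < i.pos
      · rw [toMatrix_eq_zero K x hi, zero_mul, zero_mul]
      · rw [ext0_ofFun_ext0 v h (by have := hc.2; omega)]
    rw [Finset.sum_congr rfl fun i _ => h₁ i]
    -- If `c` falls below the source interval, so does every `i ≤ c`, and both sides vanish.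
    by_cases hcb : InInterval m b c.1
    · exact proj_smul_ext0 x v hcb
    · rw [ext0_of_not _ hcb]
      refine (Finset.sum_eq_zero fun i _ => ?_).symm
      by_cases hi : c.1.pos < i.pos
      · rw [toMatrix_eq_zero K x hi, zero_mul]
      · rw [ext0_of_not v, mul_zero]
        simp only [InInterval] at hc hcb ⊢
        omega

theorem restrict_apply {b' : ℤ} (h : b' ≤ b) (v : IntervalModule K n m b)
    (c : {c : LinearQuiver n // InInterval m b' c}) : restrict h v c = v.ext0 c := rfl

theorem restrict_eq_zero_iff {b' : ℤ} (h : b' ≤ b) (v : IntervalModule K n m b) :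
    restrict h v = 0 ↔ ∀ c, InInterval m b' c → v.ext0 c = 0 :=
  ⟨fun hv c hc => congrFun hv ⟨c, hc⟩, fun hv => funext fun c => hv c.1 c.2⟩

/-- The basis vector at a vertex, if it is in the interval. -/
def single (K : Type u) [Field K] (m : ℕ) (b : ℤ) (a : LinearQuiver n) : IntervalModule K n m b :=
  ofFun m b fun c => if c = a then 1 else 0

theorem proj_smul_single (x : PathAlgebra K (LinearQuiver n)) {a : LinearQuiver n}
    (ha : InInterval m b a) (c : {c : LinearQuiver n // InInterval m b c}) :
    (proj K n m x • single K m b a) c = PathAlgebra.toMatrix K _ x c a := by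
  rw [proj_smul_apply, Finset.sum_eq_single a]
  · rw [single, ext0_ofFun _ ha]; simp
  · intro i _ hi
    by_cases h : InInterval m b i
    · rw [single, ext0_ofFun _ h]; simp [hi]
    · rw [ext0_of_not _ h, mul_zero]
  · simp

/-! ### The sum of the arrows -/

variable (K n m) in
/-- The sum of the arrows. -/
noncomputable def arrowSum : LinearBoundAlgebra K n m :=
  proj K n m (ofMatrix (Matrix.of fun c a => if c.pos = a.pos + 1 then 1 else 0))

theorem arrowSum_smul_apply (v : IntervalModule K n m b)
    (c : {c : LinearQuiver n // InInterval m b c}) :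
    (arrowSum K n m • v) c = ∑ i, if c.1.pos = i.pos + 1 then v.ext0 i else 0 := by
  rw [arrowSum, proj_smul_apply]
  refine Finset.sum_congr rfl fun i _ => ?_
  rw [toMatrix_ofMatrix, Matrix.of_apply]
  by_cases h : c.1.pos = i.pos + 1
  · rw [if_pos (by omega), if_pos h, if_pos h, one_mul]
  · rw [if_neg h, if_neg h, ite_self, zero_mul]

/-- The arrow leaving `c` moves the coordinate at `c` to the next vertex, which is still in the
interval. Hence the kernel of `arrowSum` is concentrated at the socle. -/
theorem ext0_eq_zero_of_arrowSum_smul {v : IntervalModule K n m b} (hv : arrowSum K n m • v = 0)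
    (hb : b < n) {c : LinearQuiver n} (hc : (c.pos : ℤ) < b) : v.ext0 c = 0 := by
  by_cases h : InInterval m b c
  · let c' : LinearQuiver n := vertex (c.pos + 1) (by omega)
    have hc' : c'.pos = c.pos + 1 := rfl
    have hI : InInterval m b c' := by
      simp only [InInterval] at h ⊢
      omega
    have := congrFun hv ⟨c', hI⟩
    rw [arrowSum_smul_apply, Finset.sum_eq_single c] at this
    · simpa [hc'] using! this
    · intro i _ hi
      refine if_neg fun h => hi (pos_injective ?_)
      change c'.pos = _ at h
      omega
    · simp
  · exact ext0_of_not v h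

theorem arrowSum_pow_smul (v : IntervalModule K n m b) : arrowSum K n m ^ n • v = 0 := by
  -- Each multiplication shifts coordinates up by one vertex, so the first `k` vertices are empty
  -- after `k` steps.
  have key : ∀ k, ∀ c : LinearQuiver n, c.pos < k → (arrowSum K n m ^ k • v).ext0 c = 0 := by
    intro k
    induction k with
    | zero => intro c hc; omega
    | succ k ih =>
      intro c hc
      by_cases h : InInterval m b c
      · rw [pow_succ', mul_smul, ext0_coe _ ⟨c, h⟩, arrowSum_smul_apply]
        refine Finset.sum_eq_zero fun i _ => ?_
        split_ifs with hi
        · exact ih i (by change c.pos = _ at hi; omega)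
        · rfl
      · exact ext0_of_not _ h
  funext c
  exact (ext0_coe (arrowSum K n m ^ n • v) c).symm.trans (key n c.1 c.1.pos_lt)

/-! ### Injectivity and projectivity of interval modules -/

theorem subsingleton_of_neg (hb : b < 0) : Subsingleton (IntervalModule K n m b) :=
  ⟨fun v w => funext fun c => by have := c.2.2; omega⟩

/-- A map into the interval module is determined by its coordinate at the socle: the coordinate at
`c` is obtained by first applying the path from `c` to `b`. Extending maps thus reduces to extending
`K`-linear functionals, which a linear retraction of `f` does. -/
theorem injective_of_lt (hb : b < n) :
    Module.Injective (LinearBoundAlgebra K n m) (IntervalModule K n m b) := by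
  rcases lt_or_ge b 0 with hb0 | hb0
  · have := subsingleton_of_neg (K := K) (n := n) (m := m) hb0
    exact ⟨fun X Y _ _ _ _ f _ g => ⟨0, fun x => Subsingleton.elim _ _⟩⟩
  refine ⟨fun X Y _ _ _ _ f hf g => ?_⟩
  let b' : LinearQuiver n := vertex b.toNat (by omega)
  have hb' : (b'.pos : ℤ) = b := Int.toNat_of_nonneg hb0
  let : Module K X := Module.compHom X (algebraMap K (LinearBoundAlgebra K n m))
  let : Module K Y := Module.compHom Y (algebraMap K (LinearBoundAlgebra K n m))
  have hKX : ∀ (r : K) (x : X), r • x = algebraMap K (LinearBoundAlgebra K n m) r • x :=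
    fun _ _ => rfl
  have hKY : ∀ (r : K) (y : Y), r • y = algebraMap K (LinearBoundAlgebra K n m) r • y :=
    fun _ _ => rfl
  have hsmul : ∀ (r : K) (x : LinearBoundAlgebra K n m) (y : Y), (r • x) • y = r • x • y :=
    fun r x y => by rw [hKY, Algebra.smul_def, mul_smul]
  let fK : X →ₗ[K] Y :=
    { toFun := f, map_add' := map_add f, map_smul' := fun r x => map_smul f _ x }
  obtain ⟨ret, hret⟩ := fK.exists_leftInverse_of_injective (LinearMap.ker_eq_bot.2 hf)
  let socle : X →ₗ[K] K :=
    { toFun := fun x => (g x).ext0 b'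
      map_add' := fun x y => by rw [map_add, ext0_add]
      map_smul' := fun r x => by
        rw [hKX, map_smul, RingHom.id_apply, smul_eq_mul]
        by_cases h : InInterval m b b'
        · rw [ext0_coe _ ⟨b', h⟩, ext0_coe _ ⟨b', h⟩, algebraMap_smul_apply]
        · rw [ext0_of_not _ h, ext0_of_not _ h, mul_zero] }
  let F : Y →ₗ[K] K := socle.comp ret
  have hF : ∀ x, F (f x) = (g x).ext0 b' := fun x => by
    change socle (ret (fK x)) = _
    rw [← LinearMap.comp_apply ret, hret]; rfl
  refine ⟨{ toFun := fun y => ofFun m b fun c => F (proj K n m (pathElem K c b') • y)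
            map_add' := fun y z => funext fun c => by
              rw [ofFun_apply, smul_add, map_add]; rfl
            map_smul' := fun x y => ?_ }, fun x => ?_⟩
  · obtain ⟨x, rfl⟩ := proj_surjective K m x
    funext c
    have hc := c.2
    have hcb : c.1.pos ≤ b'.pos := by have := hc.2; omega
    rw [RingHom.id_apply, proj_smul_apply, ofFun_apply, ← mul_smul, ← map_mul, pathElem_mul K hcb, map_sum,
      Finset.sum_smul, map_sum]
    refine Finset.sum_congr rfl fun i _ => ?_
    rw [map_smul (proj K n m), hsmul, map_smul F, smul_eq_mul]
    by_cases hi : InInterval m b i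
    · rw [ext0_ofFun _ hi]
    · rw [ext0_of_not _ hi]
      by_cases hci : c.1.pos < i.pos
      · rw [toMatrix_eq_zero K x hci, zero_mul, zero_mul]
      -- Here `i ≤ b - m`, so the path from `i` to the socle has length at least `m`.
      · rw [proj_pathElem_eq_zero, zero_smul, map_zero]
        simp only [InInterval] at hc hi
        omega
  · funext c
    have hc := c.2
    have hcb : c.1.pos ≤ b'.pos := by have := hc.2; omega
    have hb'I : InInterval m b b' := by
      simp only [InInterval] at hc ⊢
      omega
    change F (proj K n m (pathElem K c.1 b') • f x) = g x c
    rw [← map_smul, hF, map_smul, ext0_coe _ ⟨b', hb'I⟩, proj_pathElem_smul_apply hcb, if_pos rfl,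
      ext0_coe]

/-- This is the module P(a), cut off at the last vertex if necessary. It is a direct summand of the
algebra: `sec` sends the basis vector at `c` to the path from `a` to `c`, and acting on the basis
vector at `a` is a retraction. -/
theorem projective_of_vertex (a : LinearQuiver n) (hm : 1 ≤ m) :
    Module.Projective (LinearBoundAlgebra K n m) (IntervalModule K n m (a.pos + m - 1)) := by
  have haI : InInterval m (a.pos + m - 1) a := by
    simp only [InInterval]
    omega
  let sec : IntervalModule K n m (a.pos + m - 1) →ₗ[LinearBoundAlgebra K n m]
      LinearBoundAlgebra K n m :=
    { toFun := fun v => ∑ c, v.ext0 c • proj K n m (pathElem K a c)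
      map_add' := fun v w => by
        simp only [ext0_add, add_smul, Finset.sum_add_distrib]
      map_smul' := fun x v => by
        obtain ⟨x, rfl⟩ := proj_surjective K m x
        rw [RingHom.id_apply, smul_eq_mul, Finset.mul_sum]
        have h₁ : ∀ i, proj K n m x * v.ext0 i • proj K n m (pathElem K a i) =
            ∑ c, (PathAlgebra.toMatrix K _ x c i * v.ext0 i) • proj K n m (pathElem K a c) := by
          intro i
          by_cases hi : InInterval m (a.pos + m - 1) i
          · have hai : a.pos ≤ i.pos := by
              simp only [InInterval] at hi
              omega
            rw [mul_smul_comm, ← map_mul, mul_pathElem K hai, map_sum, Finset.smul_sum]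
            exact Finset.sum_congr rfl fun c _ => by rw [map_smul, smul_smul, mul_comm]
          · rw [ext0_of_not _ hi]; simp
        rw [Finset.sum_congr rfl fun i _ => h₁ i, Finset.sum_comm]
        refine Finset.sum_congr rfl fun c _ => ?_
        rw [← Finset.sum_smul]
        by_cases hc : InInterval m (a.pos + m - 1) c
        · rw [proj_smul_ext0 x v hc]
        · rw [ext0_of_not _ hc, zero_smul]
          by_cases hac : a.pos + m ≤ c.pos
          · rw [proj_pathElem_eq_zero K m hac, smul_zero]
          · rw [Finset.sum_eq_zero, zero_smul]
            intro i _
            by_cases hi : c.pos < i.pos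
            · rw [toMatrix_eq_zero K x hi, zero_mul]
            · rw [ext0_of_not v, mul_zero]
              simp only [InInterval] at hc ⊢
              omega }
  refine Module.Projective.of_split sec
    (LinearMap.toSpanSingleton _ _ (single K m (a.pos + m - 1) a)) (LinearMap.ext fun v => ?_)
  funext c
  have hac : a.pos ≤ c.1.pos := by
    have := c.2
    simp only [InInterval] at this
    omega
  change ((∑ i, v.ext0 i • proj K n m (pathElem K a i)) • single K m (a.pos + m - 1) a) c = v c
  rw [Finset.sum_congr rfl fun i _ => (map_smul (proj K n m) (v.ext0 i) (pathElem K a i)).symm,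
    ← map_sum, proj_smul_single _ haI, map_sum, Matrix.sum_apply, Finset.sum_eq_single c.1]
  · simp [toMatrix_pathElem, hac, ext0_coe]
  · intro i _ hi
    simp [toMatrix_pathElem, hi.symm]
  · simp

/-- Both I(b) and I(b + 1) start at vertex 0, and restriction maps the second onto the first. It
cannot split: the path from 0 to b + 1 kills the generator of I(b), but no vector of I(b + 1) with
nonzero coordinate at 0. -/
theorem not_projective (hb0 : 0 ≤ b) (hbm : b + 2 ≤ m) (hbn : b + 1 < n) :
    ¬ Module.Projective (LinearBoundAlgebra K n m) (IntervalModule K n m b) := by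
  intro hP
  let z : LinearQuiver n := vertex 0 (by omega)
  let w : LinearQuiver n := vertex (b + 1).toNat (by omega)
  have hz : z.pos = 0 := rfl
  have hw : (w.pos : ℤ) = b + 1 := Int.toNat_of_nonneg (by omega)
  have hzI : InInterval m b z := by simp only [InInterval]; omega
  have hwI : InInterval m (b + 1) w := by simp only [InInterval]; omega
  have hwb : ¬ InInterval m b w := by simp only [InInterval]; omega
  obtain ⟨σ, hσ⟩ := LinearMap.exists_rightInverse_of_surjective
    (restrict (K := K) (n := n) (m := m) (b := b + 1) (b' := b) (by omega)) <| by
      refine LinearMap.range_eq_top.2 fun v => ⟨ofFun m _ v.ext0, funext fun c => ?_⟩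
      have hc := c.2
      have hcI : InInterval m (b + 1) c.1 := by
        simp only [InInterval] at hc ⊢
        omega
      rw [restrict_apply, ext0_ofFun _ hcI]
      exact ext0_coe v c
  have h₁ : (σ (single K m b z)).ext0 z = 1 := by
    have := congrFun (LinearMap.congr_fun hσ (single K m b z)) ⟨z, hzI⟩
    rw [LinearMap.comp_apply, restrict_apply] at this
    rw [this]
    exact (if_pos rfl : (if z = z then (1 : K) else 0) = 1)
  have h₂ : proj K n m (pathElem K z w) • single K m b z = 0 := funext fun c => by
    rw [proj_pathElem_smul_apply (by omega), if_neg fun h : c.1 = w => hwb (h ▸ c.2)]; rfl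
  have h₃ := congrFun (map_smul σ (proj K n m (pathElem K z w)) (single K m b z)) ⟨w, hwI⟩
  rw [h₂, map_zero, proj_pathElem_smul_apply (by omega), if_pos rfl, h₁] at h₃
  exact zero_ne_one h₃

end IntervalModule

end LinearQuiver

namespace LinearQuiver

/-! ### The minimal injective resolution -/

/-- The socle of the `i`-th term of the minimal injective resolution of the indecomposable
projective module with top `a`; a negative value stands for the zero module. -/
def socle {n : ℕ} (m : ℕ) (a : LinearQuiver n) (i : ℕ) : ℤ :=
  if a.pos + m ≤ n then if i = 0 then a.pos + m - 1 else -1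
  else if i % 2 = 0 then n - 1 - m * (i / 2 : ℕ) else a.pos - 1 - m * (i / 2 : ℕ)

section Socle

variable {n m : ℕ} (a : LinearQuiver n)

theorem socle_zero : socle m a 0 = min (a.pos + m) n - 1 := by
  simp only [socle]
  split_ifs <;> simp <;> omega

theorem socle_one : socle m a 1 = if a.pos + m ≤ n then -1 else (a.pos : ℤ) - 1 := by
  simp [socle]

/-- This is exactness in numbers. Restriction from I(s) to I(s') has image on the vertices above s -
m, and the next kernel is the part above the next socle. The alternative is that the middle term is
zero. -/
theorem socle_add_two (i : ℕ) : socle m a (i + 1) < 0 ∨ socle m a (i + 2) = socle m a i - m := by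
  simp only [socle, ↓reduceIte, Nat.add_eq_zero_iff, one_ne_zero, OfNat.ofNat_ne_zero, and_false, Nat.add_mod_right, Nat.add_div_right _ two_pos]
  split_ifs <;> first | omega | (right; push_cast; ring)

/-- The strict drop gives minimality: each differential kills the socle of its source. -/
theorem socle_succ_lt (i : ℕ) : socle m a (i + 1) < socle m a i ∨ socle m a (i + 1) < 0 := by
  have ha := a.pos_lt
  obtain ⟨t, rfl | rfl⟩ : ∃ t, i = 2 * t ∨ i = 2 * t + 1 := ⟨i / 2, by omega⟩
  · simp only [socle, ↓reduceIte, one_ne_zero, Nat.add_eq_zero_iff, and_false, show (2 * t + 1) % 2 = 1 by omega, show (2 * t) % 2 = 0 by omega,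
      show (2 * t + 1) / 2 = t by omega, show 2 * t / 2 = t by omega]
    generalize (m : ℤ) * t = x
    split_ifs <;> omega
  · simp only [socle, ↓reduceIte, one_ne_zero, Nat.add_eq_zero_iff, and_false, show (2 * t + 1 + 1) % 2 = 0 by omega, show (2 * t + 1) % 2 = 1 by omega,
      show (2 * t + 1 + 1) / 2 = t + 1 by omega, show (2 * t + 1) / 2 = t by omega]
    have : (m : ℤ) * (t + 1 : ℕ) = m * t + m := by push_cast; ring
    rw [this]
    generalize (m : ℤ) * t = x
    split_ifs <;> omega

theorem socle_succ_le (hm : 1 ≤ m) (i : ℕ) : socle m a (i + 1) ≤ socle m a i := by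
  have ha := a.pos_lt
  obtain ⟨t, rfl | rfl⟩ : ∃ t, i = 2 * t ∨ i = 2 * t + 1 := ⟨i / 2, by omega⟩
  · simp only [socle, ↓reduceIte, one_ne_zero, Nat.add_eq_zero_iff, and_false, show (2 * t + 1) % 2 = 1 by omega, show (2 * t) % 2 = 0 by omega,
      show (2 * t + 1) / 2 = t by omega, show 2 * t / 2 = t by omega]
    generalize (m : ℤ) * t = x
    split_ifs <;> omega
  · simp only [socle, ↓reduceIte, one_ne_zero, Nat.add_eq_zero_iff, and_false, show (2 * t + 1 + 1) % 2 = 0 by omega, show (2 * t + 1) % 2 = 1 by omega,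
      show (2 * t + 1 + 1) / 2 = t + 1 by omega, show (2 * t + 1) / 2 = t by omega]
    have : (m : ℤ) * (t + 1 : ℕ) = m * t + m := by push_cast; ring
    rw [this]
    generalize (m : ℤ) * t = x
    split_ifs <;> omega

theorem socle_lt (hm : 1 ≤ m) (i : ℕ) : socle m a i < n := by
  induction i with
  | zero => rw [socle_zero]; omega
  | succ i ih => exact (socle_succ_le a hm i).trans_lt ih

end Socle

variable (K : Type u) [Field K] (n : ℕ) {m : ℕ}

/-- The terms of the minimal injective resolution. -/
abbrev ResolutionTerm (m i : ℕ) : Type u :=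
  ∀ a : LinearQuiver n, IntervalModule K n m (socle m a i)

/-- The differentials of the minimal injective resolution. -/
noncomputable def resolutionMap (hm : 1 ≤ m) (i : ℕ) :
    ResolutionTerm K n m i →ₗ[LinearBoundAlgebra K n m] ResolutionTerm K n m (i + 1) :=
  LinearMap.pi fun a =>
    (IntervalModule.restrict (socle_succ_le a hm i)).comp (LinearMap.proj a)

/-- The embedding of the regular module. -/
noncomputable def resolutionEmbedding (m : ℕ) :
    LinearBoundAlgebra K n m →ₗ[LinearBoundAlgebra K n m] ResolutionTerm K n m 0 :=
  LinearMap.pi fun a =>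
    LinearMap.toSpanSingleton _ _ (IntervalModule.single K m (socle m a 0) a)

variable {K n}

theorem resolutionMap_apply (hm : 1 ≤ m) (i : ℕ) (v : ResolutionTerm K n m i)
    (a : LinearQuiver n) (c : {c : LinearQuiver n // InInterval m (socle m a (i + 1)) c}) :
    resolutionMap K n hm i v a c = (v a).ext0 c := rfl

theorem resolutionMap_eq_zero_iff (hm : 1 ≤ m) (i : ℕ) (v : ResolutionTerm K n m i) :
    resolutionMap K n hm i v = 0 ↔
      ∀ a c, InInterval m (socle m a (i + 1)) c → (v a).ext0 c = 0 :=
  funext_iff.trans (forall_congr' fun a => IntervalModule.restrict_eq_zero_iff (socle_succ_le a hm i) (v a))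

theorem inInterval_socle_zero (hm : 1 ≤ m) (a : LinearQuiver n) :
    InInterval m (socle m a 0) a := by
  have := a.pos_lt
  rw [socle_zero]
  simp only [InInterval]
  omega

theorem resolutionEmbedding_proj_apply (hm : 1 ≤ m) (x : PathAlgebra K (LinearQuiver n))
    (a : LinearQuiver n) (c : {c : LinearQuiver n // InInterval m (socle m a 0) c}) :
    resolutionEmbedding K n m (proj K n m x) a c = PathAlgebra.toMatrix K _ x c a :=
  IntervalModule.proj_smul_single x (inInterval_socle_zero hm a) c

theorem resolutionEmbedding_injective (hm : 1 ≤ m) :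
    Function.Injective (resolutionEmbedding K n m) := by
  rw [injective_iff_map_eq_zero]
  intro x hx
  obtain ⟨x, rfl⟩ := proj_surjective K m x
  rw [eq_sum_pathElem K x, map_sum]
  refine Finset.sum_eq_zero fun a _ => ?_
  rw [map_sum]
  refine Finset.sum_eq_zero fun c _ => ?_
  rw [map_smul]
  by_cases h₁ : c.pos < a.pos
  · rw [toMatrix_eq_zero K x h₁, zero_smul]
  by_cases h₂ : a.pos + m ≤ c.pos
  · rw [proj_pathElem_eq_zero K m h₂, smul_zero]
  have hI : InInterval m (socle m a 0) c := by
    have := c.pos_lt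
    rw [socle_zero]
    simp only [InInterval]
    omega
  rw [← resolutionEmbedding_proj_apply hm x a ⟨c, hI⟩, hx]
  exact zero_smul _ _

theorem exact_resolutionEmbedding (hm : 1 ≤ m) :
    Function.Exact (resolutionEmbedding K n m) (resolutionMap K n hm 0) := by
  intro v
  rw [resolutionMap_eq_zero_iff]
  constructor
  · intro hv
    refine ⟨proj K n m (ofMatrix (Matrix.of fun c a => (v a).ext0 c)), ?_⟩
    funext a c
    rw [resolutionEmbedding_proj_apply hm, toMatrix_ofMatrix, Matrix.of_apply,
      ← IntervalModule.ext0_coe (v a) c]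
    -- A vertex `c < a` of the interval occurs only if `a + m > n`; then it survives in the next
    -- term, where `v` restricts to zero.
    refine ite_eq_left_iff.2 fun hac => (hv a c ?_).symm
    have hc := c.2
    have := a.pos_lt
    have := socle_zero (m := m) a
    rw [zero_add, socle_one]
    simp only [InInterval] at hc ⊢
    split_ifs <;> omega
  · rintro ⟨x, rfl⟩ a c hc
    obtain ⟨x, rfl⟩ := proj_surjective K m x
    by_cases h : InInterval m (socle m a 0) c
    · rw [IntervalModule.ext0_coe _ ⟨c, h⟩, resolutionEmbedding_proj_apply hm, toMatrix_eq_zero]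
      have : (c.pos : ℤ) ≤ _ := hc.2
      rw [zero_add, socle_one] at this
      change c.pos < a.pos
      split_ifs at this <;> omega
    · exact IntervalModule.ext0_of_not _ h

theorem exact_resolutionMap (hm : 1 ≤ m) (i : ℕ) :
    Function.Exact (resolutionMap K n hm i) (resolutionMap K n hm (i + 1)) := by
  intro v
  rw [resolutionMap_eq_zero_iff]
  have hs := fun a : LinearQuiver n => socle_add_two (m := m) a i
  have hle := fun a : LinearQuiver n => socle_succ_le (m := m) a hm i
  constructor
  · intro hv
    refine ⟨fun a => IntervalModule.ofFun m _ (v a).ext0, ?_⟩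
    funext a c
    rw [resolutionMap_apply]
    by_cases h : InInterval m (socle m a i) c.1
    · rw [IntervalModule.ext0_ofFun _ h, IntervalModule.ext0_coe]
    -- A vertex not reached from term `i` is at most `socle m a i - m`, so it persists in term `i +
    -- 2`.
    · rw [IntervalModule.ext0_of_not _ h, ← IntervalModule.ext0_coe (v a) c, hv a c]
      have hc := c.2
      have := hs a
      have := hle a
      have := socle_succ_le (m := m) a hm (i + 1)
      simp only [InInterval, add_assoc, Nat.reduceAdd] at *
      omega
  · rintro ⟨w, rfl⟩ a c hc
    by_cases h : InInterval m (socle m a (i + 1)) c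
    · rw [IntervalModule.ext0_coe _ ⟨c, h⟩, resolutionMap_apply, IntervalModule.ext0_of_not]
      have := hs a
      have : (c.pos : ℤ) ≤ socle m a (i + 1) := h.2
      have : (c.pos : ℤ) ≤ socle m a (i + 2) := hc.2
      simp only [InInterval]
      omega
    · exact IntervalModule.ext0_of_not _ h

/-- The range is the kernel of the next differential, so it contains the socles, hence the kernel of
the nilpotent action of `arrowSum`. -/
theorem isEssentialSubmodule_of_exact (hm : 1 ≤ m) {i : ℕ} {M : Type u} [AddCommGroup M]
    [Module (LinearBoundAlgebra K n m) M]
    (f : M →ₗ[LinearBoundAlgebra K n m] ResolutionTerm K n m i)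
    (hf : Function.Exact f (resolutionMap K n hm i)) :
    IsEssentialSubmodule (LinearMap.range f) := by
  refine isEssentialSubmodule_of_ker_smul_le _ (IntervalModule.arrowSum K n m) (fun v hv => ?_)
    fun v => ⟨n, funext fun a => IntervalModule.arrowSum_pow_smul (v a)⟩
  refine (hf v).1 ((resolutionMap_eq_zero_iff hm i v).2 fun a c hc => ?_)
  refine IntervalModule.ext0_eq_zero_of_arrowSum_smul (congrFun hv a) (socle_lt a hm i) ?_
  have := hc.2
  have := socle_succ_lt (m := m) a i
  omega

variable (K n)

/-- The minimal injective resolution of the regular module. -/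
noncomputable def resolution (hm : 1 ≤ m) :
    MinimalInjectiveResolution (LinearBoundAlgebra K n m) (LinearBoundAlgebra K n m) where
  I i := ModuleCat.of _ (ResolutionTerm K n m i)
  ε := resolutionEmbedding K n m
  d := resolutionMap K n hm
  injective_I i :=
    have := fun a : LinearQuiver n =>
      IntervalModule.injective_of_lt (K := K) (m := m) (socle_lt (m := m) a hm i)
    Module.Injective.pi (LinearBoundAlgebra K n m)
      (M := fun a : LinearQuiver n => IntervalModule K n m (socle m a i))
  injective_ε := resolutionEmbedding_injective hm
  exact_ε := exact_resolutionEmbedding hm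
  exact_d := exact_resolutionMap hm
  essential_ε := isEssentialSubmodule_of_exact hm _ (exact_resolutionEmbedding hm)
  essential_d i := isEssentialSubmodule_of_exact hm _ (exact_resolutionMap hm i)

/-! ### Projectivity of the terms and the dominant dimension -/

variable {n}

theorem projective_intervalModule (hm : 1 ≤ m) {b : ℤ} (hb : b < 0 ∨ m ≤ b + 1) (hbn : b < n) :
    Module.Projective (LinearBoundAlgebra K n m) (IntervalModule K n m b) := by
  rcases hb with hb | hb
  · have := IntervalModule.subsingleton_of_neg (K := K) (n := n) (m := m) hb
    exact Module.Projective.of_free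
  · obtain ⟨k, hk⟩ := Int.eq_ofNat_of_zero_le (show 0 ≤ b + 1 - m by omega)
    have hbk : b = ((vertex k (by omega) : LinearQuiver n).pos : ℤ) + m - 1 := by
      rw [pos_vertex]; omega
    rw [hbk]
    exact IntervalModule.projective_of_vertex _ hm

/-- One bad summand spoils term `d`, since factors of a projective product are projective. -/
theorem algDominantDimension_eq_of_socle (hm : 1 ≤ m) (d : ℕ)
    (h : ∀ i < d, ∀ a : LinearQuiver n, socle m a i < 0 ∨ m ≤ socle m a i + 1)
    (a : LinearQuiver n) (h₀ : 0 ≤ socle m a d) (h₁ : socle m a d + 2 ≤ m)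
    (h₂ : socle m a d + 1 < n) : algDominantDimension (LinearBoundAlgebra K n m) = d := by
  refine dominantDimension_eq_of_resolution (resolution K n hm) d (fun i hi => ?_) fun hP => ?_
  · exact Module.Projective.pi_of_fintype _ fun a =>
      projective_intervalModule K hm (h i hi a) (socle_lt a hm i)
  · have : Module.Projective (LinearBoundAlgebra K n m) (ResolutionTerm K n m d) := hP
    exact IntervalModule.not_projective h₀ h₁ h₂
      (Module.Projective.of_pi (fun a => IntervalModule K n m (socle m a d)) a)

/-- The dominant dimension of the linear quiver of type `A` with `m * k + j` vertices, bound by all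
paths of length `m`. -/
theorem algDominantDimension_linearBoundAlgebra {n m k j : ℕ} (hm : 2 ≤ m) (hk : 1 ≤ k)
    (hj : 1 ≤ j) (hjm : j ≤ m) (hn : n = m * k + j) :
    algDominantDimension (LinearBoundAlgebra K n m) =
      ((if j + 2 ≤ m then 2 * k - 1 else if j + 1 = m then 2 * k else 2 * k + 1 : ℕ) : ℕ∞) := by
  have hmk : m ≤ m * k := Nat.le_mul_of_pos_right m hk
  have hmul : ∀ t r : ℕ, t + r ≤ k → (m : ℤ) * t + m * r ≤ m * k := fun t r h => by
    rw [← mul_add]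
    exact mul_le_mul_of_nonneg_left (by exact_mod_cast h) (by positivity)
  have hn' : (n : ℤ) = m * k + j := by exact_mod_cast hn
  have even : ∀ (a : LinearQuiver n) (t : ℕ), n < a.pos + m →
      socle m a (2 * t) = n - 1 - m * t := fun a t h => by
    rw [socle, if_neg (by omega), if_pos (by omega), show 2 * t / 2 = t by omega]
  have odd : ∀ (a : LinearQuiver n) (t : ℕ), n < a.pos + m →
      socle m a (2 * t + 1) = a.pos - 1 - m * t := fun a t h => by
    rw [socle, if_neg (by omega), if_neg (by omega), show (2 * t + 1) / 2 = t by omega]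
  -- The first vertex whose projective is not injective; it has the lowest socles at odd indices.
  let a₀ : LinearQuiver n := vertex (n - m + 1) (by omega)
  have ha₀ : (a₀.pos : ℤ) = n - m + 1 := by
    change ((n - m + 1 : ℕ) : ℤ) = _
    omega
  -- The bounds say that the socle is at least `m - 1` at even indices, and at odd indices in the
  -- worst case `a₀`.
  have early : ∀ (d i : ℕ), i < d →
      (∀ t, 2 * t < d → (m : ℤ) ≤ n - m * t) → (∀ t, 2 * t + 1 < d → 2 * (m : ℤ) ≤ n - m * t + 1) →
      ∀ a : LinearQuiver n, socle m a i < 0 ∨ m ≤ socle m a i + 1 := by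
    intro d i hi h₀ h₁ a
    by_cases ha : a.pos + m ≤ n
    · rw [socle, if_pos ha]
      split_ifs <;> omega
    · right
      obtain ⟨t, rfl | rfl⟩ : ∃ t, i = 2 * t ∨ i = 2 * t + 1 := ⟨i / 2, by omega⟩
      · rw [even a t (by omega)]
        have := h₀ t hi
        omega
      · rw [odd a t (by omega)]
        have := h₁ t hi
        omega
  split_ifs with h₁ h₂
  · obtain ⟨k, rfl⟩ := Nat.exists_eq_add_of_le' hk
    rw [show 2 * (k + 1) - 1 = 2 * k + 1 by omega]
    have hsoc : socle m a₀ (2 * k + 1) = j := by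
      rw [odd a₀ k (by omega), ha₀, hn']; push_cast; ring
    refine algDominantDimension_eq_of_socle K (by omega) _
      (fun i hi => early _ i hi (fun t ht => ?_) fun t ht => ?_) a₀ (by omega) (by omega) (by omega)
    · have := hmul t 1 (by omega)
      push_cast at *
      linarith
    · have := hmul t 2 (by omega)
      push_cast at *
      linarith
  · have hsoc : socle m a₀ (2 * k) = j - 1 := by
      rw [even a₀ k (by omega), hn']; ring
    refine algDominantDimension_eq_of_socle K (by omega) _
      (fun i hi => early _ i hi (fun t ht => ?_) fun t ht => ?_) a₀ (by omega) (by omega) (by omega)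
    · have := hmul t 1 (by omega)
      push_cast at *
      linarith
    · have := hmul t 1 (by omega)
      have : (j : ℤ) + 1 = m := by exact_mod_cast h₂
      push_cast at *
      linarith
  · have hj' : (j : ℤ) = m := by omega
    have hsoc : socle m a₀ (2 * k + 1) = 0 := by
      rw [odd a₀ k (by omega), ha₀, hn', hj']; ring
    refine algDominantDimension_eq_of_socle K (by omega) _
      (fun i hi => early _ i hi (fun t ht => ?_) fun t ht => ?_) a₀ (by omega) (by omega) (by omega)
    · have := hmul t 0 (by omega)
      push_cast at *
      linarith
    · have := hmul t 1 (by omega)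
      push_cast at *
      linarith

end LinearQuiver

/-! ### The three claims of the theorem -/

theorem mainTheorem4 (K : Type u) [Field K] :
    (∀ n : ℕ, 3 ≤ n →
      algDominantDimension (LinearBoundAlgebra K n 2) = ((n - 1 : ℕ) : ℕ∞)) ∧
    (∀ m n k j : ℕ, 3 ≤ m → 1 ≤ k → 1 ≤ j → j ≤ m → n = m * k + j →
      ∃ d : ℕ, algDominantDimension (LinearBoundAlgebra K n m) = (d : ℕ∞) ∧
        (j + 2 ≤ m → (d : ℚ) = (2 * (n : ℚ) - ((m : ℚ) + 2 * (j : ℚ))) / (m : ℚ)) ∧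
        (j + 1 = m → (d : ℚ) = (2 * (n : ℚ) - 2 * (j : ℚ)) / (m : ℚ)) ∧
        (j = m → (d : ℚ) = (2 * (n : ℚ) - (j : ℚ)) / (m : ℚ))) ∧
    (∀ d : ℕ, 1 ≤ d → ∃ n m : ℕ, 3 ≤ n ∧ 2 ≤ m ∧ m < n ∧
      algDominantDimension (LinearBoundAlgebra K n m) = (d : ℕ∞)) := by
  have two : ∀ n : ℕ, 3 ≤ n →
      algDominantDimension (LinearBoundAlgebra K n 2) = ((n - 1 : ℕ) : ℕ∞) := by
    intro n hn
    -- For `m = 2` the remainder `j` is 1 or 2, and the values `2 * k` and `2 * k + 1` both equal `n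
    -- - 1`.
    rw [LinearQuiver.algDominantDimension_linearBoundAlgebra K (k := (n - 1) / 2)
      (j := (n - 1) % 2 + 1) le_rfl (by omega) (by omega) (by omega) (by omega)]
    congr 1
    split_ifs <;> omega
  refine ⟨two, fun m n k j hm hk hj hjm hn => ?_, fun d hd => ?_⟩
  · refine ⟨_, LinearQuiver.algDominantDimension_linearBoundAlgebra K (by omega) hk hj hjm hn,
      fun h => ?_, fun h => ?_, fun h => ?_⟩
    all_goals
      have hm0 : (m : ℚ) ≠ 0 := by
        have : m ≠ 0 := by omega
        exact_mod_cast this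
      have hn' : (n : ℚ) = m * k + j := by exact_mod_cast hn
      rw [eq_div_iff hm0, hn']
    · rw [if_pos h, Nat.cast_sub (by omega)]
      push_cast
      ring
    · rw [if_neg (by omega), if_pos h]
      push_cast
      ring
    · rw [if_neg (by omega), if_neg (by omega), h]
      push_cast
      ring
  · rcases hd.eq_or_lt with rfl | hd
    -- With `m = 2` and `n ≥ 3` only values from 2 on occur, so 1 needs `m = 3`, `k = j = 1`.
    · exact ⟨4, 3, by omega, by omega, by omega,
        LinearQuiver.algDominantDimension_linearBoundAlgebra K (k := 1) (j := 1) (by omega) le_rfl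
          le_rfl (by omega) rfl⟩
    · exact ⟨d + 1, 2, by omega, le_rfl, by omega, two (d + 1) (by omega)⟩
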